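/- Let $I=[a,b]\subset\mathbb{R}$ be a closed interval and let $f\colon I\to I$ be a continuous map with zero topological entropy. Let $K\subseteq I$ be a minimal subset of $f$, that is, a closed set with $f(K)\subseteq K$ and $\overline{\{f^n(x) : n\ge 1\}}=K$ for every $x\in K$. Then every ergodic $f|_K$-invariant Borel probability measure $\mu$ on $K$ has discrete spectrum: the complex Hilbert space $L^2(K,\mu)$ has an orthonormal basis consisting of eigenfunctions, i.e. of nonzero $\varphi\in L^2(K,\mu)$ for which there is $\lambda\in\mathbb{C}$ with $\varphi(f(x))=\lambda\varphi(x)$ for $\mu$-almost every $x\in K$. -/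

import Mathlib

open MeasureTheory

/-- A closed set `K` is minimal for `f` if it is forward invariant and the forward orbit
`{f^n x | n ≥ 1}` of each of its points has closure `K`. -/
structure IsMinimalSubset {X : Type*} [TopologicalSpace X] (f : X → X) (K : Set X) : Prop where
  isClosed : IsClosed K
  mapsTo : Set.MapsTo f K K
  closure_orbit : ∀ x ∈ K, closure {y | ∃ n : ℕ, 1 ≤ n ∧ f^[n] x = y} = K

/-- A nonzero `φ ∈ L²(μ)` is an eigenfunction of `T` if `φ (T x) = c * φ x` for `μ`-a.e. `x`,
for some complex number `c`. -/
def IsEigenfunction {X : Type*} [MeasurableSpace X] (T : X → X) (μ : Measure X)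
    (φ : Lp ℂ 2 μ) : Prop :=
  φ ≠ 0 ∧ ∃ c : ℂ, ∀ᵐ x ∂μ, φ (T x) = c * φ x

/-- `(T, μ)` has discrete spectrum if `L²(μ)` has an orthonormal (Hilbert) basis consisting of
eigenfunctions. -/
def HasDiscreteSpectrum {X : Type*} [MeasurableSpace X] (T : X → X) (μ : Measure X) : Prop :=
  ∃ (S : Set (Lp ℂ 2 μ)) (b : HilbertBasis S ℂ (Lp ℂ 2 μ)),
    (∀ φ : S, b φ = (φ : Lp ℂ 2 μ)) ∧ ∀ φ ∈ S, IsEigenfunction T μ φ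

/-! A horseshoe forces positive entropy (`HasHorseshoe.coverEntropy_pos`), so `f` and its iterates
have none. Without horseshoes, a nontrivial compact minimal set is cut by a point `z` into a left
and a right part that the map exchanges (`IsMinimalSubset.exists_division`). The parts have equal
measure and each is minimal for the second iterate (`IsMinimalSubset.iterate_two`), so the cutting
can be repeated inside either of them.

Every piece so obtained is periodic, and the indicator of a periodic set is a finite sum of
eigenfunctions. Given a ray `Iic t`, each cut leaves at most one piece straddling `t`, of half the
previous measure, unless the piece has shrunk to a point (`exists_isDiscreteSet_subset_ray`). Hence
indicators of rays lie in the closed span of the eigenfunctions. Rays generate the Borel sets, so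
this span is all of `L²`, and eigenspaces of an isometry are mutually orthogonal. -/

/-! ### Horseshoes and positive entropy. -/

/-- Some iterate of `f` maps each of two disjoint compact sets over both of them. -/
def HasHorseshoe {X : Type*} [TopologicalSpace X] (f : X → X) : Prop :=
  ∃ N : ℕ, 0 < N ∧ ∃ S : Bool → Set X, (∀ i, IsCompact (S i)) ∧ (S true).Nonempty ∧
    Disjoint (S true) (S false) ∧ ∀ i j, S j ⊆ f^[N] '' S i

/-- Every itinerary is realised. -/
theorem exists_itinerary {X : Type*} {f : X → X} {N : ℕ} {S : Bool → Set X}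
    (hne : (S true).Nonempty) (hS : ∀ i j, S j ⊆ f^[N] '' S i) (k : ℕ) (w : ℕ → Bool) :
    ∃ x, (∃ j, x ∈ S j) ∧ ∀ i < k, f^[N * i] x ∈ S (w i) := by
  induction k generalizing w with
  | zero => exact ⟨hne.some, ⟨true, hne.some_mem⟩, by simp⟩
  | succ k ih =>
    obtain ⟨y, ⟨j, hj⟩, hy⟩ := ih fun i ↦ w (i + 1)
    obtain ⟨x, hx, rfl⟩ := hS (w 0) j hj
    refine ⟨x, ⟨_, hx⟩, ?_⟩
    rintro (_ | i) hi
    · simpa using hx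
    · have := hy i (by omega)
      rwa [← Function.iterate_add_apply, ← Nat.mul_succ] at this

-- The `2 ^ k` itineraries of length `k` give points whose orbits separate within time `N * k`, so
-- the entropy is at least `log 2 / N`.
open Dynamics in
theorem HasHorseshoe.coverEntropy_pos {X : Type*} [PseudoMetricSpace X] [T2Space X] {f : X → X}
    (h : HasHorseshoe f) : 0 < coverEntropy f Set.univ := by
  classical
  obtain ⟨N, hN, S, hc, hne, hd, hS⟩ := h
  obtain ⟨δ, hδ, hsep⟩ := Metric.exists_pos_forall_lt_edist (hc true) (hc false).isClosed hd
  have hsep' : ∀ i j, i ≠ j → ∀ x ∈ S i, ∀ y ∈ S j, (δ : ℝ) < dist x y := by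
    have key : ∀ x ∈ S true, ∀ y ∈ S false, (δ : ℝ) < dist x y := fun x hx y hy ↦ by
      have := hsep x hx y hy
      rw [edist_nndist] at this
      exact_mod_cast this
    rintro (_ | _) (_ | _) hij x hx y hy
    · exact absurd rfl hij
    · rw [dist_comm]; exact key y hy x hx
    · exact key x hx y hy
    · exact absurd rfl hij
  -- Half the separation of the two sets, so that dynamical balls around points with different
  -- itineraries are disjoint.
  set U : SetRel X X := {p | dist p.1 p.2 < δ / 2} with hU
  have hUu : U ∈ uniformity X := Metric.dist_mem_uniformity (by positivity)
  have hcard : ∀ k, (2 : ENNReal) ^ k ≤ (netMaxcard f Set.univ U (N * k) : ℕ∞) := by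
    intro k
    choose x _ hx using fun w : Fin k → Bool ↦
      exists_itinerary hne hS k fun i ↦ if h : i < k then w ⟨i, h⟩ else true
    have hx' : ∀ w i, f^[N * (i : Fin k)] (x w) ∈ S (w i) := fun w i ↦ by
      simpa using hx w i i.2
    have hsepx : ∀ w w', w ≠ w' → Disjoint (UniformSpace.ball (x w) (dynEntourage f U (N * k)))
        (UniformSpace.ball (x w') (dynEntourage f U (N * k))) := by
      intro w w' hne
      obtain ⟨i, hi⟩ := Function.ne_iff.1 hne
      rw [Set.disjoint_left]
      intro y hy hy'
      rw [mem_ball_dynEntourage] at hy hy'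
      have hlt : N * (i : ℕ) < N * k := Nat.mul_lt_mul_of_pos_left i.2 hN
      have h1 : dist (f^[N * (i : ℕ)] (x w)) (f^[N * (i : ℕ)] y) < δ / 2 := hy _ hlt
      have h2 : dist (f^[N * (i : ℕ)] (x w')) (f^[N * (i : ℕ)] y) < δ / 2 := hy' _ hlt
      have h3 := hsep' _ _ hi _ (hx' w i) _ (hx' w' i)
      have h4 := dist_triangle_right (f^[N * (i : ℕ)] (x w)) (f^[N * (i : ℕ)] (x w'))
        (f^[N * (i : ℕ)] y)
      linarith
    have hinj : Function.Injective x := by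
      intro w w' hww
      by_contra hne
      have := hsepx w w' hne
      rw [hww, disjoint_self] at this
      have hmem : x w' ∈ UniformSpace.ball (x w') (dynEntourage f U (N * k)) := by
        rw [mem_ball_dynEntourage]
        intro j _
        change dist _ _ < _
        rw [dist_self]
        positivity
      rw [this] at hmem
      exact hmem
    have hnet : IsDynNetIn f Set.univ U (N * k) (Finset.univ.image x : Finset X) := by
      refine ⟨Set.subset_univ _, ?_⟩
      intro a ha b hb hab
      simp only [Finset.coe_image, Finset.coe_univ, Set.image_univ, Set.mem_range] at ha hb
      obtain ⟨w, rfl⟩ := ha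
      obtain ⟨w', rfl⟩ := hb
      exact hsepx w w' fun h ↦ hab (by rw [h])
    have := hnet.card_le_netMaxcard
    rw [Finset.card_image_of_injective _ hinj] at this
    have h2 := ENat.toENNReal_mono this
    simpa using h2
  refine lt_of_lt_of_le ?_ (netEntropyEntourage_le_coverEntropy f Set.univ hUu)
  -- The growth rate of `c ^ n` is `log 2 / N`. Since the entropy is a limsup, comparing at the
  -- multiples of `N` is enough.
  set c : ENNReal := 2 ^ (1 / (N : ℝ)) with hcdef
  have hc1 : 1 < c := ENNReal.one_lt_rpow (by norm_num) (by positivity)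
  have hcN : c ^ N = 2 := by
    rw [hcdef, ← ENNReal.rpow_natCast, ← ENNReal.rpow_mul, one_div_mul_cancel (by positivity),
      ENNReal.rpow_one]
  refine lt_of_lt_of_le (ENNReal.zero_lt_log_iff.2 hc1) ?_
  rw [← ExpGrowth.expGrowthInf_pow]
  refine ExpGrowth.expGrowthInf_le_expGrowthSup_of_frequently_le ?_
  rw [Filter.frequently_atTop]
  intro n
  refine ⟨N * n, Nat.le_mul_of_pos_left n hN, ?_⟩
  rw [pow_mul, hcN]
  exact hcard n

/-! ### Minimal sets of interval maps without horseshoes. -/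

namespace IsMinimalSubset

variable {X : Type*} [TopologicalSpace X] {f : X → X} {K : Set X}

theorem iterate_mem (hK : IsMinimalSubset f K) {x : X} (hx : x ∈ K) (n : ℕ) : f^[n] x ∈ K :=
  hK.mapsTo.iterate n hx

theorem subset_of_mapsTo (hK : IsMinimalSubset f K) {C : Set X} (hC : IsClosed C)
    (hf : Set.MapsTo f C C) {x : X} (hx : x ∈ K) (hxC : x ∈ C) : K ⊆ C := by
  rw [← hK.closure_orbit x hx]
  refine closure_minimal ?_ hC
  rintro _ ⟨n, -, rfl⟩
  exact hf.iterate n hxC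

theorem exists_iterate_mem (hK : IsMinimalSubset f K) {V : Set X} (hV : IsOpen V) {x y : X}
    (hx : x ∈ K) (hy : y ∈ K) (hyV : y ∈ V) : ∃ n, 1 ≤ n ∧ f^[n] x ∈ V := by
  rw [← hK.closure_orbit x hx, mem_closure_iff] at hy
  obtain ⟨_, hv, n, hn, rfl⟩ := hy V hV hyV
  exact ⟨n, hn, hv⟩

theorem map_ne_self [T1Space X] (hK : IsMinimalSubset f K) (hnt : K.Nontrivial) {x : X}
    (hx : x ∈ K) : f x ≠ x := by
  intro h
  obtain ⟨y, hy, hne⟩ := hnt.exists_ne x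
  exact hne (hK.subset_of_mapsTo (C := {x}) isClosed_singleton
    (by rintro _ rfl; exact h) hx rfl hy)

end IsMinimalSubset

/-- If a point moving down lies to the left of a point moving up in the same minimal set, then
there is a horseshoe. -/
theorem HasHorseshoe.of_moving_apart {g : ℝ → ℝ} (hg : Continuous g) {K : Set ℝ}
    (hK : IsMinimalSubset g K) {d u : ℝ} (hd : d ∈ K) (hu : u ∈ K) (hdu : d < u) (hgd : g d < d)
    (hgu : u < g u) : HasHorseshoe g := by
  -- `z` will be the last fixed point before `u`; on `(z, u]` the map moves points up.
  obtain ⟨z, ⟨⟨hdz, hzu⟩, hgz⟩, hz⟩ :=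
    (isCompact_Icc.inter_right (isClosed_le hg continuous_id)).exists_isGreatest
      (s := Set.Icc d u ∩ {x | g x ≤ x}) ⟨d, ⟨le_rfl, hdu.le⟩, hgd.le⟩
  have hgz : g z = z := by
    obtain ⟨x, hx, hx0⟩ := intermediate_value_Icc hzu (f := fun x ↦ g x - x) (by fun_prop)
      (show (0 : ℝ) ∈ _ from ⟨by simpa using hgz, by linarith⟩)
    have hx0 : g x = x := by linarith
    have := hz ⟨⟨hdz.trans hx.1, hx.2⟩, hx0.le⟩
    rwa [← le_antisymm this hx.1]
  have hzu : z < u := lt_of_le_of_ne hzu fun h ↦ by rw [h] at hgz; linarith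
  have hdz : d < z := lt_of_le_of_ne hdz fun h ↦ by rw [← h] at hgz; linarith
  have hup : ∀ x, z < x → x ≤ u → x < g x := fun x hzx hxu ↦ by
    by_contra! h
    exact absurd (hz ⟨⟨(hdz.trans hzx).le, hxu⟩, h⟩) (not_le.2 hzx)
  -- Otherwise the part of `K` to the right of `z` is invariant, and the orbit of `u` cannot
  -- approach `d`.
  obtain ⟨v, hv, hzv, hgv⟩ : ∃ v ∈ K, z < v ∧ g v ≤ z := by
    by_contra! h
    have hsub := hK.subset_of_mapsTo (C := K ∩ Set.Ici z) (hK.isClosed.inter isClosed_Ici)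
      (by
        rintro x ⟨hx, hzx⟩
        refine ⟨hK.mapsTo hx, ?_⟩
        rcases eq_or_lt_of_le (show z ≤ x from hzx) with rfl | hlt
        · exact hgz.ge
        · exact (h x hx hlt).le) hu ⟨hu, hzu.le⟩
    exact absurd (hsub hd).2 (not_le.2 hdz)
  have huv : u < v := by
    by_contra! h
    linarith [hup v hzv h]
  -- `β` is the first point after `u` that is mapped back to `z`.
  obtain ⟨β, ⟨⟨huβ, -⟩, hgβ⟩, hβ⟩ :=
    (isCompact_Icc.inter_right (isClosed_le hg continuous_const)).exists_isLeast
      (s := Set.Icc u v ∩ {x | g x ≤ z}) ⟨v, ⟨huv.le, le_rfl⟩, hgv⟩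
  have hgβ : g β ≤ z := hgβ
  have habove : ∀ x, z < x → x < β → z < g x := fun x hzx hxβ ↦ by
    rcases le_total x u with h | h
    · exact hzx.trans (hup x hzx h)
    · by_contra! hc
      have := hβ ⟨⟨h, hxβ.le.trans (hβ ⟨⟨huv.le, le_rfl⟩, hgv⟩)⟩, hc⟩
      linarith
  have hzβ : z < β := hzu.trans_le huβ
  have hgβ : g β = z := by
    obtain ⟨x, hx, hgx⟩ := intermediate_value_Icc' huβ hg.continuousOn
      (show z ∈ _ from ⟨hgβ, by linarith⟩)
    rcases eq_or_lt_of_le hx.2 with rfl | hlt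
    · exact hgx
    · linarith [habove x (hzu.trans_le hx.1) hlt]
  -- Otherwise `[z, β]` is invariant and again traps the orbit of `u`.
  obtain ⟨α, ⟨hzα, hαβ⟩, hgα⟩ : ∃ α ∈ Set.Icc z β, β ≤ g α := by
    by_contra! h
    have hsub := hK.subset_of_mapsTo (C := Set.Icc z β) isClosed_Icc
      (by
        intro x hx
        refine ⟨?_, (h x hx).le⟩
        rcases eq_or_lt_of_le hx.1 with rfl | h1
        · exact hgz.ge
        rcases eq_or_lt_of_le hx.2 with rfl | h2
        · exact hgβ.ge
        · exact (habove x h1 h2).le) hu ⟨hzu.le, huβ⟩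
    exact absurd (hsub hd).1 (not_le.2 hdz)
  have hzα : z < α := lt_of_le_of_ne hzα fun h ↦ by rw [← h] at hgα; linarith
  have hαβ : α < β := lt_of_le_of_ne hαβ fun h ↦ by rw [h] at hgα; linarith
  have hleft : Set.Icc z β ⊆ g '' Set.Icc z α :=
    (Set.Icc_subset_Icc hgz.le hgα).trans (intermediate_value_Icc hzα.le hg.continuousOn)
  have hright : Set.Icc z β ⊆ g '' Set.Icc α β :=
    (Set.Icc_subset_Icc hgβ.le hgα).trans (intermediate_value_Icc' hαβ.le hg.continuousOn)
  set J : Bool → Set ℝ := fun i ↦ if i then Set.Icc z α else Set.Icc α β with hJ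
  have hJc : ∀ i, IsCompact (J i) := by rintro (_ | _) <;> exact isCompact_Icc
  have hJs : ∀ i, J i ⊆ Set.Icc z β := by
    rintro (_ | _)
    · exact Set.Icc_subset_Icc_left hzα.le
    · exact Set.Icc_subset_Icc_right hαβ.le
  have hcov : ∀ i, Set.Icc z β ⊆ g '' J i := by
    rintro (_ | _)
    · exact hright
    · exact hleft
  -- Both `[z, α]` and `[α, β]` cover `[z, β]`, but they share `α`. Repeating each symbol twice
  -- removes it, because `g α ≥ β > α`.
  refine ⟨2, two_pos, fun i ↦ J i ∩ g ⁻¹' J i, fun i ↦ ?_, ⟨z, ?_, ?_⟩, ?_, ?_⟩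
  · exact (hJc i).inter_right ((hJc i).isClosed.preimage hg)
  · exact ⟨le_rfl, hzα.le⟩
  · rw [Set.mem_preimage, hgz]
    exact ⟨le_rfl, hzα.le⟩
  · rw [Set.disjoint_left]
    rintro x ⟨⟨_, h1⟩, ⟨_, h2⟩⟩ ⟨⟨h3, _⟩, _⟩
    obtain rfl := le_antisymm h1 h3
    linarith
  · rintro i j y ⟨hy, -⟩
    obtain ⟨x, hx, rfl⟩ := hcov i (hJs j hy)
    obtain ⟨w, hw, rfl⟩ := hcov i (hJs i hx)
    exact ⟨w, ⟨hw, hx⟩, rfl⟩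

theorem subset_image_iterate_add {X : Type*} {g : X → X} {A B C : Set X} {m n : ℕ}
    (hAB : B ⊆ g^[m] '' A) (hBC : C ⊆ g^[n] '' B) : C ⊆ g^[m + n] '' A := by
  rw [add_comm, Function.iterate_add, Set.image_comp]
  exact hBC.trans (Set.image_mono hAB)

/-- If a minimal set has a gap around a fixed point `z` whose endpoints are swapped, and some point
stays on the left of `z`, then there is a horseshoe. -/
theorem HasHorseshoe.of_stays_left {X : Type*} [ConditionallyCompleteLinearOrder X]
    [TopologicalSpace X] [OrderTopology X] [DenselyOrdered X] {g : X → X} (hg : Continuous g)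
    {K : Set X} (hK : IsMinimalSubset g K) (hKc : IsCompact K) {p z q : X} (hp : p ∈ K)
    (hpz : p < z) (hzq : z < q) (hgz : g z = z) (hgap : ∀ x ∈ K, x < z → x ≤ p)
    (hgp : q ≤ g p) (hgq : g q ≤ p) (hstay : ∃ u ∈ K, u < z ∧ g u < z) : HasHorseshoe g := by
  have hclosed : IsClosed {x | x ≤ p ∧ g x ≤ p} :=
    (isClosed_le continuous_id continuous_const).inter (isClosed_le hg continuous_const)
  obtain ⟨u₀, hu₀, hu₀z, hgu₀z⟩ := hstay
  -- With `u` the rightmost point of `K` that stays on the left, any visit of the orbit of `p` to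
  -- such points lands at or below `u`; hence some `g^[n]` maps `[p, z]` over `[u, p]`.
  obtain ⟨u, ⟨hu, hup, hgu⟩, hmax⟩ :=
    (hKc.inter_right hclosed).exists_isGreatest
      ⟨u₀, hu₀, hgap _ hu₀ hu₀z, hgap _ (hK.mapsTo hu₀) hgu₀z⟩
  obtain ⟨n, -, hnz, hgnz⟩ := hK.exists_iterate_mem (V := {x | x < z ∧ g x < z})
    ((isOpen_lt continuous_id continuous_const).inter (isOpen_lt hg continuous_const)) hp hu₀
    ⟨hu₀z, hgu₀z⟩
  have hn : g^[n] p ≤ u := hmax ⟨hK.iterate_mem hp n, hgap _ (hK.iterate_mem hp n) hnz,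
    hgap _ (hK.mapsTo (hK.iterate_mem hp n)) hgnz⟩
  have hJ : Set.Icc p q ⊆ g^[1] '' Set.Icc u p :=
    (Set.Icc_subset_Icc hgu hgp).trans (intermediate_value_Icc hup hg.continuousOn)
  have hJ0 : Set.Icc p z ⊆ g^[1] '' Set.Icc u p := (Set.Icc_subset_Icc_right hzq.le).trans hJ
  have hJ1 : Set.Icc z q ⊆ g^[1] '' Set.Icc u p := (Set.Icc_subset_Icc_left hpz.le).trans hJ
  have h10 : Set.Icc p z ⊆ g^[1] '' Set.Icc z q :=
    (Set.Icc_subset_Icc hgq hgz.ge).trans (intermediate_value_Icc' hzq.le hg.continuousOn)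
  have hznz : g^[n] z = z := Function.iterate_fixed hgz n
  have h0J : Set.Icc u p ⊆ g^[n] '' Set.Icc p z :=
    (Set.Icc_subset_Icc hn (hpz.le.trans hznz.ge)).trans
      (intermediate_value_Icc hpz.le (hg.iterate n).continuousOn)
  set I : Bool → Set X := fun i ↦ if i then Set.Icc p z else Set.Icc z q with hI
  have hIc : ∀ i, IsClosed (I i) := by rintro (_ | _) <;> exact isClosed_Icc
  have hJI : ∀ i, I i ⊆ g^[1] '' Set.Icc u p := by
    rintro (_ | _)
    · exact hJ1
    · exact hJ0
  -- There are two loops at `[u, p]`: through `[p, z]`, of length `n + 1`, and through `[z, q]` and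
  -- then `[p, z]`, of length `n + 2`. Composing them in either order gives the common length `2 * n
  -- + 3`.
  have hIJ : ∀ i, Set.Icc u p ⊆ g^[2 * n + 2] '' I i := by
    rintro (_ | _)
    · have := subset_image_iterate_add (subset_image_iterate_add (subset_image_iterate_add h10 h0J)
        hJ0) h0J
      rwa [show 1 + n + 1 + n = 2 * n + 2 by ring] at this
    · have := subset_image_iterate_add (subset_image_iterate_add (subset_image_iterate_add h0J hJ1)
        h10) h0J
      rwa [show n + 1 + 1 + n = 2 * n + 2 by ring] at this
  have hcov : ∀ i, Set.Icc u p ⊆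
      g^[2 * n + 3] '' (Set.Icc u p ∩ (g ⁻¹' I i ∩ g^[2 * n + 3] ⁻¹' Set.Icc u p)) := by
    intro i y hy
    obtain ⟨w, hw, rfl⟩ := hIJ i hy
    obtain ⟨x, hx, rfl⟩ := hJI i hw
    exact ⟨x, ⟨hx, hw, hy⟩, rfl⟩
  refine ⟨2 * n + 3, by omega,
    fun i ↦ Set.Icc u p ∩ (g ⁻¹' I i ∩ g^[2 * n + 3] ⁻¹' Set.Icc u p), fun i ↦ ?_, ?_, ?_, ?_⟩
  · exact isCompact_Icc.inter_right
      (((hIc i).preimage hg).inter (isClosed_Icc.preimage (hg.iterate _)))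
  · obtain ⟨x, hx, -⟩ := hcov true (Set.left_mem_Icc.2 hup)
    exact ⟨x, hx⟩
  -- A common point would be sent by `g` to the fixed point `z` and never return to `[u, p]`.
  · rw [Set.disjoint_left]
    rintro x ⟨_, ⟨_, h1⟩, _, h2⟩ ⟨_, ⟨h3, _⟩, _⟩
    have hx : g x = z := le_antisymm h1 h3
    rw [Function.iterate_succ_apply, hx, Function.iterate_fixed hgz] at h2
    exact absurd hpz (not_lt.2 h2)
  · exact fun i j ↦ Set.inter_subset_left.trans (hcov i)

/-- In the absence of horseshoes a nontrivial compact minimal set is divided by a point into two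
parts that are exchanged by the map. -/
theorem IsMinimalSubset.exists_division {g : ℝ → ℝ} (hg : Continuous g) (hgh : ¬ HasHorseshoe g)
    {K : Set ℝ} (hK : IsMinimalSubset g K) (hKc : IsCompact K) (hnt : K.Nontrivial) :
    ∃ z, z ∉ K ∧ (∀ x ∈ K, x < z → z < g x) ∧ ∀ x ∈ K, z < x → g x < z := by
  have hne := fun x hx ↦ hK.map_ne_self hnt (x := x) hx
  obtain ⟨m, hm, hmin⟩ := hKc.exists_isLeast hnt.nonempty
  obtain ⟨M, hM, hmax⟩ := hKc.exists_isGreatest hnt.nonempty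
  obtain ⟨p, ⟨hp, hgp⟩, hpmax⟩ := (hKc.inter_right (isClosed_le continuous_id hg)).exists_isGreatest
    (s := K ∩ {x | x ≤ g x}) ⟨m, hm, hmin (hK.mapsTo hm)⟩
  obtain ⟨q, ⟨hq, hgq⟩, hqmin⟩ := (hKc.inter_right (isClosed_le hg continuous_id)).exists_isLeast
    (s := K ∩ {x | g x ≤ x}) ⟨M, hM, hmax (hK.mapsTo hM)⟩
  have hgp : p < g p := lt_of_le_of_ne hgp (hne p hp).symm
  have hgq : g q < q := lt_of_le_of_ne hgq (hne q hq)
  -- `p` is the last point of `K` moving up and `q` the first moving down, so `p < q` makes `(p, q)`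
  -- a gap of `K`.
  have hpq : p < q := by
    by_contra! h
    rcases eq_or_lt_of_le h with rfl | h
    · linarith
    · exact hgh (.of_moving_apart hg hK hq hp h hgq hgp)
  obtain ⟨z, ⟨hpz, hzq⟩, hz0⟩ := intermediate_value_Icc' hpq.le (f := fun x ↦ g x - x)
    (by fun_prop) (show (0 : ℝ) ∈ _ from ⟨by linarith, by linarith⟩)
  have hgz : g z = z := by linarith
  have hzK : z ∉ K := fun h ↦ hne z h hgz
  have hpz : p < z := lt_of_le_of_ne hpz fun h ↦ hzK (h ▸ hp)
  have hzq : z < q := lt_of_le_of_ne hzq fun h ↦ hzK (h ▸ hq)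
  have hdich : ∀ x ∈ K, x ≤ p ∨ q ≤ x := fun x hx ↦ by
    rcases le_total x (g x) with h | h
    · exact .inl (hpmax ⟨hx, h⟩)
    · exact .inr (hqmin ⟨hx, h⟩)
  have hgapL : ∀ x ∈ K, x < z → x ≤ p := fun x hx h ↦
    (hdich x hx).resolve_right (by linarith)
  have hgapR : ∀ x ∈ K, z < x → q ≤ x := fun x hx h ↦
    (hdich x hx).resolve_left (by linarith)
  have hgp' : q ≤ g p := (hdich _ (hK.mapsTo hp)).resolve_left (by linarith)
  have hgq' : g q ≤ p := (hdich _ (hK.mapsTo hq)).resolve_right (by linarith)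
  refine ⟨z, hzK, fun x hx hxz ↦ ?_, fun x hx hxz ↦ ?_⟩
  · by_contra! h
    have h : g x < z := lt_of_le_of_ne h fun h ↦ hzK (h ▸ hK.mapsTo hx)
    exact hgh (.of_stays_left hg hK hKc hp hpz hzq hgz hgapL hgp' hgq' ⟨x, hx, hxz, h⟩)
  · by_contra! h
    have h : z < g x := lt_of_le_of_ne h fun h ↦ hzK (h ▸ hK.mapsTo hx)
    -- The right side is the left side for the reversed order.
    exact hgh (HasHorseshoe.of_stays_left (X := ℝᵒᵈ) hg hK hKc hq hzq hpz hgz hgapR hgq' hgp'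
      ⟨x, hx, hxz, h⟩)

/-- The map alternates between `V` and `W`, so returns to `V` happen only at even times. -/
theorem IsMinimalSubset.iterate_two {X : Type*} [TopologicalSpace X] {g : X → X} {K V W : Set X}
    (hK : IsMinimalSubset g K) (hV : IsOpen V) (hW : IsOpen W) (hd : Disjoint V W)
    (hKVW : K ⊆ V ∪ W) (hVW : ∀ x ∈ K, x ∈ V → g x ∈ W) (hWV : ∀ x ∈ K, x ∈ W → g x ∈ V) :
    IsMinimalSubset g^[2] (K ∩ V) := by
  have hcl : IsClosed (K ∩ V) := by
    have : K ∩ V = K ∩ Wᶜ := by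
      ext x
      refine and_congr_right fun hx ↦ ⟨fun h h' ↦ Set.disjoint_left.1 hd h h', fun h ↦ ?_⟩
      exact (hKVW hx).resolve_right h
    rw [this]
    exact hK.isClosed.inter hW.isClosed_compl
  have hmaps : Set.MapsTo g^[2] (K ∩ V) (K ∩ V) := fun x hx ↦
    ⟨hK.iterate_mem hx.1 2, hWV _ (hK.mapsTo hx.1) (hVW x hx.1 hx.2)⟩
  refine ⟨hcl, hmaps, fun x hx ↦ (closure_minimal ?_ hcl).antisymm ?_⟩
  · rintro _ ⟨n, -, rfl⟩
    exact hmaps.iterate n hx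
  · intro y hy
    rw [mem_closure_iff]
    intro O hO hyO
    obtain ⟨n, hn, hnO, hnV⟩ := hK.exists_iterate_mem (hO.inter hV) hx.1 hy.1 ⟨hyO, hy.2⟩
    rcases Nat.even_or_odd' n with ⟨k, rfl | rfl⟩
    · refine ⟨_, hnO, k, by omega, ?_⟩
      rw [← Function.iterate_mul]
    · have h1 : (g^[2])^[k] x ∈ K ∩ V := hmaps.iterate k hx
      rw [← Function.iterate_mul] at h1
      rw [Function.iterate_succ_apply'] at hnV
      exact absurd (hVW _ h1.1 h1.2) (Set.disjoint_left.1 hd hnV)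

/-! ### Eigenvectors of linear isometries. -/

section Isometry

variable {H : Type*} [NormedAddCommGroup H] [InnerProductSpace ℂ H]

/-- Eigenvalues of nonzero vectors are unimodular, so preserving a nonzero inner product would give
`conj c * d = 1`, that is `c = d`. -/
theorem LinearIsometry.inner_eq_zero_of_eigenvalue_ne (U : H →ₗᵢ[ℂ] H) {c d : ℂ} (hcd : c ≠ d)
    {x y : H} (hx : U x = c • x) (hy : U y = d • y) : inner ℂ x y = 0 := by
  by_cases hx0 : x = 0
  · simp [hx0]
  have hc : ‖c‖ = 1 := by
    have := U.norm_map x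
    rw [hx, norm_smul] at this
    exact mul_right_cancel₀ (norm_ne_zero_iff.2 hx0) (this.trans (one_mul _).symm)
  have h := U.inner_map_map x y
  rw [hx, hy, inner_smul_left, inner_smul_right] at h
  by_contra h0
  have h1 : (starRingEnd ℂ) c * d = 1 := by
    rw [← mul_assoc] at h
    exact mul_right_cancel₀ h0 (h.trans (one_mul _).symm)
  have h2 : c * (starRingEnd ℂ) c = 1 := by rw [Complex.mul_conj', hc]; norm_num
  apply hcd
  calc c = c * ((starRingEnd ℂ) c * d) := by rw [h1, mul_one]
    _ = d := by rw [← mul_assoc, h2, one_mul]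

/-- A linear isometry whose eigenvectors span a dense subspace has an orthonormal basis of
eigenvectors. -/
theorem LinearIsometry.exists_hilbertBasis_eigenvectors [CompleteSpace H] (U : H →ₗᵢ[ℂ] H)
    (hU : (Submodule.span ℂ {x | ∃ c : ℂ, U x = c • x}).topologicalClosure = ⊤) :
    ∃ (S : Set H) (b : HilbertBasis S ℂ H), (∀ x : S, b x = (x : H)) ∧
      ∀ x ∈ S, x ≠ 0 ∧ ∃ c : ℂ, U x = c • x := by
  let E : ℂ → Submodule ℂ H := fun c ↦ LinearMap.eqLocus U.toLinearMap (c • LinearMap.id)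
  have hE : ∀ c x, x ∈ E c ↔ U x = c • x := fun c x ↦ Iff.rfl
  have hEc : ∀ c, IsClosed (E c : Set H) := fun c ↦
    isClosed_eq U.continuous (continuous_const_smul c)
  have : ∀ c, CompleteSpace (E c) := fun c ↦ (hEc c).completeSpace_coe
  choose w b hb using fun c ↦ exists_hilbertBasis ℂ (E c)
  let S : Set H := ⋃ c, (↑) '' (w c)
  have hS : ∀ x ∈ S, ∃ c, ∃ y : w c, ((y : E c) : H) = x := by
    intro x hx
    obtain ⟨c, y, hy, rfl⟩ := Set.mem_iUnion.1 hx
    exact ⟨c, ⟨y, hy⟩, rfl⟩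
  have hon : ∀ c, Orthonormal ℂ ((↑) : w c → E c) := fun c ↦ hb c ▸ (b c).orthonormal
  have horth : Orthonormal ℂ ((↑) : S → H) := by
    constructor
    · rintro ⟨x, hx⟩
      obtain ⟨c, y, rfl⟩ := hS x hx
      exact (hon c).1 y
    · rintro ⟨x, hx⟩ ⟨x', hx'⟩ hne
      obtain ⟨c, y, rfl⟩ := hS x hx
      obtain ⟨c', y', rfl⟩ := hS x' hx'
      by_cases hcc : c = c'
      · subst hcc
        exact (hon c).2 fun h ↦ hne (by rw [Subtype.mk.injEq, h])
      · exact U.inner_eq_zero_of_eigenvalue_ne hcc (y : E c).2 (y' : E c').2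
  have hdense : ⊤ ≤ (Submodule.span ℂ (Set.range ((↑) : S → H))).topologicalClosure := by
    rw [← hU, Subtype.range_coe]
    refine Submodule.topologicalClosure_minimal _ (Submodule.span_le.2 ?_)
      (Submodule.isClosed_topologicalClosure _)
    rintro x ⟨c, hx⟩
    have h1 : (⟨x, hx⟩ : E c) ∈ (Submodule.span ℂ (w c)).topologicalClosure := by
      have := (b c).dense_span
      rw [hb c, Subtype.range_coe] at this
      rw [this]
      trivial
    have h2 := image_closure_subset_closure_image (E c).subtypeL.continuous
      (Set.mem_image_of_mem _ h1)
    refine closure_mono ?_ h2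
    rintro _ ⟨y, hy, rfl⟩
    have h3 := Submodule.mem_map_of_mem (f := (E c).subtype) hy
    rw [Submodule.map_span] at h3
    exact Submodule.span_mono (Set.subset_iUnion (fun c ↦ ((↑) : E c → H) '' w c) c) h3
  refine ⟨S, HilbertBasis.mk horth hdense, fun x ↦ by simp, fun x hx ↦ ?_⟩
  refine ⟨horth.ne_zero ⟨x, hx⟩, ?_⟩
  obtain ⟨c, y, rfl⟩ := hS x hx
  exact ⟨c, (y : E c).2⟩

/-- Periodic vectors of an endomorphism are sums of eigenvectors. -/
theorem LinearMap.mem_span_eigenvectors_of_iterate_eq {M : Type*} [AddCommGroup M] [Module ℂ M]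
    (U : M →ₗ[ℂ] M) {m : ℕ} (hm : 0 < m) {x : M} (hx : U^[m] x = x) :
    x ∈ Submodule.span ℂ {y | ∃ c : ℂ, U y = c • y} := by
  set ζ : ℂ := Complex.exp (2 * Real.pi * Complex.I / m) with hζdef
  have hζ : IsPrimitiveRoot ζ m := Complex.isPrimitiveRoot_exp m hm.ne'
  have hζ0 : ζ ≠ 0 := hζ.ne_zero hm.ne'
  -- Discrete Fourier transform of the periodic orbit of `x`; summing over all frequencies recovers
  -- `m • x`.
  let ψ : ℕ → M := fun k ↦ ∑ j ∈ Finset.range m, ((ζ ^ k)⁻¹) ^ j • U^[j] x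
  have hψ : ∀ k, U (ψ k) = ζ ^ k • ψ k := by
    intro k
    have h0 : ζ ^ k ≠ 0 := pow_ne_zero _ hζ0
    have hper : ((ζ ^ k)⁻¹) ^ m • U^[m] x = ((ζ ^ k)⁻¹) ^ 0 • U^[0] x := by
      rw [hx, inv_pow, ← pow_mul, mul_comm, pow_mul, hζ.pow_eq_one]
      simp
    have hshift : ∑ j ∈ Finset.range m, ((ζ ^ k)⁻¹) ^ (j + 1) • U^[j + 1] x = ψ k := by
      have h1 := Finset.sum_range_succ (fun j ↦ ((ζ ^ k)⁻¹) ^ j • U^[j] x) m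
      have h2 := Finset.sum_range_succ' (fun j ↦ ((ζ ^ k)⁻¹) ^ j • U^[j] x) m
      rw [h1, hper] at h2
      exact (add_right_cancel h2).symm
    conv_rhs => rw [← hshift]
    change U (∑ j ∈ Finset.range m, ((ζ ^ k)⁻¹) ^ j • U^[j] x) = _
    rw [map_sum, Finset.smul_sum]
    refine Finset.sum_congr rfl fun j _ ↦ ?_
    rw [map_smul, ← Function.iterate_succ_apply' U j x, smul_smul, pow_succ']
    rw [← mul_assoc, mul_inv_cancel₀ h0, one_mul]
  have hsum : ∑ k ∈ Finset.range m, ψ k = (m : ℂ) • x := by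
    simp only [ψ]
    rw [Finset.sum_comm]
    rw [Finset.sum_eq_single_of_mem 0 (Finset.mem_range.2 hm)]
    · simp [← Nat.cast_smul_eq_nsmul ℂ]
    · intro j hj hj0
      rw [← Finset.sum_smul]
      have hne : (ζ⁻¹) ^ j ≠ 1 := hζ.inv.pow_ne_one_of_pos_of_lt hj0 (Finset.mem_range.1 hj)
      have hgeom : ∑ k ∈ Finset.range m, ((ζ ^ k)⁻¹) ^ j = 0 := by
        have h1 := mul_geom_sum ((ζ⁻¹) ^ j) m
        rw [← pow_mul, mul_comm j, pow_mul, hζ.inv.pow_eq_one, one_pow, sub_self] at h1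
        have h2 := (mul_eq_zero.1 h1).resolve_left (sub_ne_zero.2 hne)
        rw [← h2]
        refine Finset.sum_congr rfl fun k _ ↦ ?_
        rw [← inv_pow, ← pow_mul, ← pow_mul, mul_comm]
      rw [hgeom, zero_smul]
  have hm0 : (m : ℂ) ≠ 0 := by exact_mod_cast hm.ne'
  have hxm : x = (m : ℂ)⁻¹ • ∑ k ∈ Finset.range m, ψ k := by
    rw [hsum, smul_smul, inv_mul_cancel₀ hm0, one_smul]
  rw [hxm]
  exact Submodule.smul_mem _ _ (Submodule.sum_mem _ fun k _ ↦ Submodule.subset_span ⟨_, hψ k⟩)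

end Isometry

/-! ### Sets whose indicators are limits of sums of eigenfunctions. -/

section Koopman

variable {X : Type*} [MeasurableSpace X] {μ : Measure X} {T : X → X}

/-- The closed span of the eigenvectors of the Koopman operator. -/
noncomputable def discretePart (hT : MeasurePreserving T μ μ) : Submodule ℂ (Lp ℂ 2 μ) :=
  (Submodule.span ℂ
    {φ | ∃ c : ℂ, Lp.compMeasurePreservingₗᵢ ℂ T hT φ = c • φ}).topologicalClosure

theorem hasDiscreteSpectrum_of_discretePart_eq_top (hT : MeasurePreserving T μ μ)
    (h : discretePart hT = ⊤) : HasDiscreteSpectrum T μ := by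
  obtain ⟨S, b, hb, hS⟩ := LinearIsometry.exists_hilbertBasis_eigenvectors _ h
  refine ⟨S, b, hb, fun φ hφ ↦ ⟨(hS φ hφ).1, ?_⟩⟩
  obtain ⟨c, hc⟩ := (hS φ hφ).2
  refine ⟨c, ?_⟩
  have h1 := Lp.coeFn_compMeasurePreserving φ hT
  have h2 := Lp.coeFn_smul c φ
  rw [← hc] at h2
  filter_upwards [h1, h2] with x hx1 hx2
  exact hx1.symm.trans hx2

variable [IsFiniteMeasure μ]

/-- The indicator function of `s` lies in the closed span of the eigenfunctions. -/
def IsDiscreteSet (hT : MeasurePreserving T μ μ) (s : Set X) : Prop :=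
  ∃ hs : MeasurableSet s, indicatorConstLp 2 hs (measure_ne_top μ s) (1 : ℂ) ∈ discretePart hT

theorem iterate_koopman_indicatorConstLp (hT : MeasurePreserving T μ μ) {s : Set X}
    (hs : MeasurableSet s) (n : ℕ) :
    (Lp.compMeasurePreservingₗᵢ ℂ T hT).toLinearMap^[n]
        (indicatorConstLp 2 hs (measure_ne_top μ s) (1 : ℂ)) =
      indicatorConstLp 2 ((hT.iterate n).measurable hs) (measure_ne_top μ _) (1 : ℂ) := by
  induction n with
  | zero => rfl
  | succ n ih =>
    rw [Function.iterate_succ_apply', ih]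
    rfl

namespace IsDiscreteSet

variable {hT : MeasurePreserving T μ μ} {s t : Set X}

theorem empty : IsDiscreteSet hT ∅ := by
  refine ⟨.empty, ?_⟩
  rw [indicatorConstLp_empty]
  exact zero_mem _

/-- `s` and its preimage have equal finite measure, so the inclusion is an equality almost
everywhere and the indicator is a periodic vector of the Koopman operator. -/
theorem of_subset_preimage_iterate (hs : MeasurableSet s) {m : ℕ} (hm : 0 < m)
    (h : s ⊆ T^[m] ⁻¹' s) : IsDiscreteSet hT s := by
  refine ⟨hs, Submodule.le_topologicalClosure _ ?_⟩
  refine LinearMap.mem_span_eigenvectors_of_iterate_eq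
    (Lp.compMeasurePreservingₗᵢ ℂ T hT).toLinearMap hm ?_
  rw [iterate_koopman_indicatorConstLp, indicatorConstLp_inj _ _ _ _ one_ne_zero]
  exact (ae_eq_of_subset_of_measure_ge h
    ((hT.iterate m).measure_preimage hs.nullMeasurableSet).le hs.nullMeasurableSet
    (measure_ne_top _ _)).symm

theorem union (hs : IsDiscreteSet hT s) (ht : IsDiscreteSet hT t) (hst : Disjoint s t) :
    IsDiscreteSet hT (s ∪ t) := by
  obtain ⟨hs, hs'⟩ := hs
  obtain ⟨ht, ht'⟩ := ht
  refine ⟨hs.union ht, ?_⟩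
  rw [indicatorConstLp_disjoint_union hs ht (measure_ne_top _ _) (measure_ne_top _ _) hst]
  exact add_mem hs' ht'

theorem compl (hs : IsDiscreteSet hT s) : IsDiscreteSet hT sᶜ := by
  obtain ⟨hs, hs'⟩ := hs
  obtain ⟨hu, hu'⟩ : IsDiscreteSet hT Set.univ :=
    of_subset_preimage_iterate .univ one_pos (Set.subset_univ _)
  refine ⟨hs.compl, ?_⟩
  have h := indicatorConstLp_disjoint_union (p := 2) (μ := μ) hs hs.compl (measure_ne_top _ _)
    (measure_ne_top _ _) disjoint_compl_right (1 : ℂ)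
  simp only [Set.union_compl_self] at h
  rw [← sub_eq_iff_eq_add'.2 h]
  exact sub_mem hu' hs'

theorem of_tendsto {A : ℕ → Set X} (hA : ∀ n, IsDiscreteSet hT (A n)) (hs : MeasurableSet s)
    (h : Filter.Tendsto (fun n ↦ μ (symmDiff (A n) s)) Filter.atTop (nhds 0)) :
    IsDiscreteSet hT s :=
  ⟨hs, (Submodule.isClosed_topologicalClosure _).mem_of_tendsto
    (tendsto_indicatorConstLp_set (ht := fun n ↦ (hA n).1) (hμt := fun n ↦ measure_ne_top _ _)
      (by simp) h)
    (Filter.Eventually.of_forall fun n ↦ (hA n).2)⟩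

theorem iUnion {A : ℕ → Set X} (hd : Pairwise (Function.onFun Disjoint A))
    (hA : ∀ n, IsDiscreteSet hT (A n)) : IsDiscreteSet hT (⋃ n, A n) := by
  have hm : ∀ n, MeasurableSet (A n) := fun n ↦ (hA n).1
  have hacc : ∀ n, IsDiscreteSet hT (Set.accumulate A n) := by
    intro n
    induction n with
    | zero => simpa [Set.accumulate_zero_nat] using hA 0
    | succ n ih =>
      rw [Set.accumulate_succ]
      exact ih.union (hA _) (Set.disjoint_accumulate hd n.lt_succ_self)
  refine of_tendsto hacc (.iUnion hm) ?_
  have hsub : ∀ n, Set.accumulate A n ⊆ ⋃ n, A n := fun n ↦ Set.accumulate_subset_iUnion n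
  have h1 := tendsto_measure_iUnion_accumulate (μ := μ) (f := A)
  have h2 := ENNReal.Tendsto.sub (tendsto_const_nhds (x := μ (⋃ n, A n))) h1
    (.inl (measure_ne_top _ _))
  rw [tsub_self] at h2
  refine h2.congr fun n ↦ ?_
  rw [Set.symmDiff_def, Set.sdiff_eq_empty.2 (hsub n), Set.empty_union,
    measure_sdiff (hsub n) (hacc n).1.nullMeasurableSet (measure_ne_top _ _)]

end IsDiscreteSet

theorem discretePart_eq_top (hT : MeasurePreserving T μ μ)
    (h : ∀ s, MeasurableSet s → IsDiscreteSet hT s) : discretePart hT = ⊤ := by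
  rw [eq_top_iff]
  rintro φ -
  refine Lp.induction (by simp) (fun φ ↦ φ ∈ discretePart hT) ?_ ?_ ?_ φ
  · intro c s hs hμs
    have := Submodule.smul_mem _ c (h s hs).2
    convert this using 1
    rw [Lp.simpleFunc.coe_indicatorConst]
    refine Lp.ext ?_
    filter_upwards [indicatorConstLp_coeFn (p := 2) (hs := hs) (hμs := hμs.ne) (c := c),
      Lp.coeFn_smul c (indicatorConstLp 2 hs (measure_ne_top μ s) (1 : ℂ)),
      indicatorConstLp_coeFn (p := 2) (hs := hs) (hμs := hμs.ne) (c := (1 : ℂ))] with x h1 h2 h3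
    rw [h1, h2, Pi.smul_apply, h3]
    by_cases hx : x ∈ s <;> simp [hx]
  · intro f g hf hg _ h1 h2
    exact add_mem h1 h2
  · exact Submodule.isClosed_topologicalClosure _

end Koopman

/-! ### Approximation of rays by periodic pieces. -/

theorem HasHorseshoe.of_iterate {X : Type*} [TopologicalSpace X] {f : X → X} {m : ℕ} (hm : 0 < m)
    (h : HasHorseshoe f^[m]) : HasHorseshoe f := by
  obtain ⟨N, hN, S, hc, hne, hd, hS⟩ := h
  refine ⟨m * N, Nat.mul_pos hm hN, S, hc, hne, hd, ?_⟩
  rwa [Function.iterate_mul]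

section Rays

variable {X : Type*} [MeasurableSpace X] {μ : Measure X} {T : X → X} {F : ℝ → ℝ} {π : X → ℝ}

/-- Two sets exchanged by an iterate have the same measure. -/
theorem measure_preimage_eq_of_exchanged (hT : MeasurePreserving T μ μ) (hπ : Measurable π)
    (hsc : Function.Semiconj π T F) {C D : Set ℝ} (hC : MeasurableSet C) (hD : MeasurableSet D)
    {m : ℕ} (hCD : Set.MapsTo F^[m] C D) (hDC : Set.MapsTo F^[m] D C) :
    μ (π ⁻¹' C) = μ (π ⁻¹' D) := by
  have key : ∀ {C D : Set ℝ}, MeasurableSet D → Set.MapsTo F^[m] C D →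
      μ (π ⁻¹' C) ≤ μ (π ⁻¹' D) := fun {C D} hD h ↦ by
    rw [← (hT.iterate m).measure_preimage (hπ hD).nullMeasurableSet]
    refine measure_mono fun x hx ↦ ?_
    rw [Set.mem_preimage, Set.mem_preimage, (hsc.iterate_right m).eq]
    exact h hx
  exact (key hD hCD).antisymm (key hC hDC)

variable [IsFiniteMeasure μ] {hT : MeasurePreserving T μ μ}

theorem IsDiscreteSet.preimage_of_mapsTo_iterate (hπ : Measurable π)
    (hsc : Function.Semiconj π T F) {C : Set ℝ} (hC : IsClosed C) {m : ℕ} (hm : 0 < m)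
    (hmaps : Set.MapsTo F^[m] C C) : IsDiscreteSet hT (π ⁻¹' C) := by
  refine .of_subset_preimage_iterate (hπ hC.measurableSet) hm fun x hx ↦ ?_
  rw [Set.mem_preimage, Set.mem_preimage, (hsc.iterate_right m).eq]
  exact hmaps hx

/-- Rays are approximated from below by discrete sets; the error is contained in a minimal set of
an iterate which is either small or trivial. -/
theorem exists_isDiscreteSet_subset_ray (hF : Continuous F) (hFh : ¬ HasHorseshoe F)
    (hπ : Measurable π) (hsc : Function.Semiconj π T F) (hKc : IsCompact (Set.range π))
    (hK : IsMinimalSubset F (Set.range π)) (t : ℝ) (k : ℕ) :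
    ∃ (A : Set X) (C : Set ℝ) (m : ℕ), 0 < m ∧ IsDiscreteSet hT A ∧ IsMinimalSubset F^[m] C ∧
      IsCompact C ∧ Disjoint A (π ⁻¹' C) ∧ A ⊆ π ⁻¹' Set.Iic t ∧
      π ⁻¹' Set.Iic t ⊆ A ∪ π ⁻¹' C ∧
      (C.Subsingleton ∨ 2 ^ k * μ (π ⁻¹' C) ≤ μ Set.univ) := by
  induction k with
  | zero =>
    refine ⟨∅, Set.range π, 1, one_pos, .empty, hK, hKc, Set.empty_disjoint _,
      Set.empty_subset _, ?_, .inr ?_⟩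
    · simp
    · simp
  | succ k ih =>
    obtain ⟨A, C, m, hm, hA, hC, hCc, hdisj, hAt, htA, hor⟩ := ih
    by_cases hCs : C.Subsingleton
    · exact ⟨A, C, m, hm, hA, hC, hCc, hdisj, hAt, htA, .inl hCs⟩
    have hor := hor.resolve_left hCs
    obtain ⟨z, hzC, hLR, hRL⟩ := hC.exists_division (hF.iterate m)
      (fun h ↦ hFh (h.of_iterate hm)) hCc (Set.not_subsingleton_iff.1 hCs)
    have hdLR : Disjoint (Set.Iio z) (Set.Ioi z) :=
      Set.disjoint_left.2 fun x hx hx' ↦ lt_asymm (show x < z from hx) hx'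
    have hcovLR : C ⊆ Set.Iio z ∪ Set.Ioi z := fun x hx ↦
      lt_or_gt_of_ne (ne_of_mem_of_not_mem hx hzC)
    have hminL := hC.iterate_two isOpen_Iio isOpen_Ioi hdLR hcovLR hLR hRL
    have hminR := hC.iterate_two isOpen_Ioi isOpen_Iio hdLR.symm
      (by rwa [Set.union_comm]) hRL hLR
    rw [← Function.iterate_mul] at hminL hminR
    have hm2 : 0 < m * 2 := by omega
    have hcL : IsCompact (C ∩ Set.Iio z) := hCc.of_isClosed_subset hminL.isClosed
      Set.inter_subset_left
    have hcR : IsCompact (C ∩ Set.Ioi z) := hCc.of_isClosed_subset hminR.isClosed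
      Set.inter_subset_left
    have hdL : IsDiscreteSet hT (π ⁻¹' (C ∩ Set.Iio z)) :=
      .preimage_of_mapsTo_iterate hπ hsc hminL.isClosed hm2 hminL.mapsTo
    have hμ : μ (π ⁻¹' (C ∩ Set.Iio z)) = μ (π ⁻¹' (C ∩ Set.Ioi z)) :=
      measure_preimage_eq_of_exchanged hT hπ hsc hminL.isClosed.measurableSet
        hminR.isClosed.measurableSet (fun x hx ↦ ⟨hC.mapsTo hx.1, hLR x hx.1 hx.2⟩)
        (fun x hx ↦ ⟨hC.mapsTo hx.1, hRL x hx.1 hx.2⟩)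
    have hsum : 2 * μ (π ⁻¹' (C ∩ Set.Ioi z)) = μ (π ⁻¹' C) := by
      have hC' : π ⁻¹' C = π ⁻¹' (C ∩ Set.Iio z) ∪ π ⁻¹' (C ∩ Set.Ioi z) := by
        rw [← Set.preimage_union, ← Set.inter_union_distrib_left,
          Set.inter_eq_left.2 hcovLR]
      rw [hC', measure_union _ (hπ hminR.isClosed.measurableSet), hμ, two_mul]
      exact ((hdLR.mono Set.inter_subset_right Set.inter_subset_right).preimage π)
    have hbound : 2 ^ (k + 1) * μ (π ⁻¹' (C ∩ Set.Ioi z)) ≤ μ Set.univ := by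
      rwa [pow_succ, mul_assoc, hsum]
    have hAC : ∀ x ∈ A, π x ∉ C := fun x hx ↦ Set.disjoint_left.1 hdisj hx
    -- If `t < z` the right half misses the ray and the left half is the new error; otherwise the
    -- left half lies in the ray and joins `A`, and the right half is the new error.
    rcases lt_or_ge t z with htz | hzt
    · refine ⟨A, C ∩ Set.Iio z, m * 2, hm2, hA, hminL, hcL, ?_, hAt, ?_, .inr (hμ ▸ hbound)⟩
      · exact Set.disjoint_left.2 fun x hx h ↦ hAC x hx h.1
      · intro x hx
        exact (htA hx).imp_right fun h ↦ ⟨h, lt_of_le_of_lt hx htz⟩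
    · refine ⟨A ∪ π ⁻¹' (C ∩ Set.Iio z), C ∩ Set.Ioi z, m * 2, hm2, hA.union hdL ?_, hminR, hcR,
        ?_, ?_, ?_, .inr hbound⟩
      · exact Set.disjoint_left.2 fun x hx h ↦ hAC x hx h.1
      · refine Set.disjoint_left.2 fun x hx h ↦ ?_
        rcases hx with hx | hx
        · exact hAC x hx h.1
        · exact Set.disjoint_left.1 hdLR hx.2 h.2
      · refine Set.union_subset hAt fun x hx ↦ ?_
        exact (show π x < z from hx.2).le.trans hzt
      · intro x hx
        rcases htA hx with h | h
        · exact .inl (.inl h)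
        · exact (hcovLR h).elim (fun h' ↦ .inl (.inr ⟨h, h'⟩)) fun h' ↦ .inr ⟨h, h'⟩

theorem isDiscreteSet_preimage_Iic (hF : Continuous F) (hFh : ¬ HasHorseshoe F)
    (hπ : Measurable π) (hsc : Function.Semiconj π T F) (hKc : IsCompact (Set.range π))
    (hK : IsMinimalSubset F (Set.range π)) (t : ℝ) : IsDiscreteSet hT (π ⁻¹' Set.Iic t) := by
  have happrox : ∀ k : ℕ, ∃ A, IsDiscreteSet hT A ∧
      μ (symmDiff A (π ⁻¹' Set.Iic t)) ≤ μ Set.univ * (2⁻¹) ^ k := by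
    intro k
    obtain ⟨A, C, m, hm, hA, hC, -, hdisj, hAt, htA, hor⟩ :=
      exists_isDiscreteSet_subset_ray (hT := hT) hF hFh hπ hsc hKc hK t k
    rcases hor with hor | hor
    -- When the error set is a single point, that point is periodic, so its fibre is itself discrete
    -- and the ray is obtained exactly.
    · rcases hor.eq_empty_or_singleton with rfl | ⟨c, rfl⟩
      · refine ⟨A, hA, ?_⟩
        rw [Set.preimage_empty, Set.union_empty] at htA
        simp [hAt.antisymm htA]
      · rcases le_or_gt c t with hct | htc
        · refine ⟨A ∪ π ⁻¹' {c}, hA.union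
            (.preimage_of_mapsTo_iterate hπ hsc isClosed_singleton hm hC.mapsTo) hdisj, ?_⟩
          have : A ∪ π ⁻¹' {c} = π ⁻¹' Set.Iic t := (Set.union_subset hAt
            fun x hx ↦ (show π x = c from hx).le.trans hct).antisymm htA
          simp [this]
        · refine ⟨A, hA, ?_⟩
          have : A = π ⁻¹' Set.Iic t := hAt.antisymm fun x hx ↦ (htA hx).resolve_right
            fun h ↦ absurd (show π x ≤ t from hx) (by rw [show π x = c from h]; exact not_le.2 htc)
          simp [← this]
    · refine ⟨A, hA, ?_⟩
      have hsub : symmDiff A (π ⁻¹' Set.Iic t) ⊆ π ⁻¹' C := by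
        rintro x (⟨h1, h2⟩ | ⟨h1, h2⟩)
        · exact absurd (hAt h1) h2
        · exact (htA h1).resolve_left h2
      refine (measure_mono hsub).trans ?_
      rw [← ENNReal.inv_pow, ← div_eq_mul_inv,
        ENNReal.le_div_iff_mul_le (by simp) (by simp), mul_comm]
      exact hor
  choose A hA hAμ using happrox
  refine .of_tendsto hA (hπ measurableSet_Iic) ?_
  refine tendsto_of_tendsto_of_tendsto_of_le_of_le tendsto_const_nhds ?_ (fun _ ↦ zero_le) hAμ
  have := ENNReal.Tendsto.const_mul (a := μ Set.univ)
    (ENNReal.tendsto_pow_atTop_nhds_zero_of_lt_one (r := 2⁻¹) (by simp))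
    (.inr (measure_ne_top _ _))
  simpa using this

/-- A measure preserving system that embeds in an interval map without horseshoes, with a compact
minimal image, has discrete spectrum. -/
theorem hasDiscreteSpectrum_of_not_hasHorseshoe (hT : MeasurePreserving T μ μ) (hF : Continuous F)
    (hFh : ¬ HasHorseshoe F) (hπ : MeasurableEmbedding π) (hsc : Function.Semiconj π T F)
    (hKc : IsCompact (Set.range π)) (hK : IsMinimalSubset F (Set.range π)) :
    HasDiscreteSpectrum T μ := by
  refine hasDiscreteSpectrum_of_discretePart_eq_top hT (discretePart_eq_top hT ?_)
  have hgen : ‹MeasurableSpace X› =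
      MeasurableSpace.generateFrom (Set.preimage π '' Set.range Set.Iic) := by
    rw [← MeasurableSpace.comap_generateFrom, ← borel_eq_generateFrom_Iic ℝ, hπ.comap_eq.symm,
      ← BorelSpace.measurable_eq (α := ℝ)]
  have hpi : IsPiSystem (Set.preimage π '' Set.range Set.Iic) := by
    convert (isPiSystem_Iic (α := ℝ)).comap π using 1
    ext s
    simp
  -- Discrete sets are closed under complements and disjoint countable unions, so Dynkin's π-λ
  -- theorem reduces everything to rays.
  refine MeasurableSpace.induction_on_inter (C := fun s _ ↦ IsDiscreteSet hT s) hgen hpi .empty ?_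
    (fun s _ hs ↦ hs.compl) (fun f hd _ hf ↦ .iUnion hd hf)
  rintro _ ⟨_, ⟨t, rfl⟩, rfl⟩
  exact isDiscreteSet_preimage_Iic hF hFh hπ.measurable hsc hKc hK t

end Rays

/-! ### Transfer from `[a, b]` to the real line, and conclusion. -/

theorem IsMinimalSubset.image {X Y : Type*} [TopologicalSpace X] [TopologicalSpace Y] {f : X → X}
    {g : Y → Y} {e : X → Y} (he : Topology.IsClosedEmbedding e) (hsc : Function.Semiconj e f g)
    {K : Set X} (hK : IsMinimalSubset f K) : IsMinimalSubset g (e '' K) := by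
  refine ⟨he.isClosedMap _ hK.isClosed, ?_, ?_⟩
  · rintro _ ⟨x, hx, rfl⟩
    exact ⟨f x, hK.mapsTo hx, hsc x⟩
  · rintro _ ⟨x, hx, rfl⟩
    rw [← hK.closure_orbit x hx, ← he.closure_image_eq]
    congr 1
    ext y
    constructor
    · rintro ⟨n, hn, rfl⟩
      exact ⟨_, ⟨n, hn, rfl⟩, (hsc.iterate_right n).eq x⟩
    · rintro ⟨_, ⟨n, hn, rfl⟩, rfl⟩
      exact ⟨n, hn, ((hsc.iterate_right n).eq x).symm⟩

/-- Each set of the horseshoe is covered by an image under `g`, so it lies in the range of `e` and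
can be pulled back. -/
theorem HasHorseshoe.of_semiconj {X Y : Type*} [TopologicalSpace X] [TopologicalSpace Y]
    {f : X → X} {g : Y → Y} {e : X → Y} (he : Topology.IsClosedEmbedding e)
    (hsc : Function.Semiconj e f g) (hg : Set.range g ⊆ Set.range e) (h : HasHorseshoe g) :
    HasHorseshoe f := by
  obtain ⟨N, hN, S, hc, hne, hd, hS⟩ := h
  have hSe : ∀ i, S i ⊆ Set.range e := fun i y hy ↦ by
    obtain ⟨x, -, rfl⟩ := hS i i hy
    obtain ⟨k, rfl⟩ := Nat.exists_eq_succ_of_ne_zero hN.ne'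
    rw [Function.iterate_succ_apply']
    exact hg ⟨_, rfl⟩
  refine ⟨N, hN, fun i ↦ e ⁻¹' S i, fun i ↦ he.isCompact_preimage (hc i), ?_, hd.preimage e, ?_⟩
  · obtain ⟨y, hy⟩ := hne
    obtain ⟨x, rfl⟩ := hSe _ hy
    exact ⟨x, hy⟩
  · intro i j x hx
    obtain ⟨y, hy, hyx⟩ := hS i j hx
    obtain ⟨w, rfl⟩ := hSe _ hy
    refine ⟨w, hy, he.injective ?_⟩
    rw [(hsc.iterate_right N).eq, hyx]

theorem corollary1p4 (a b : ℝ) (hab : a ≤ b)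
    (f : Set.Icc a b → Set.Icc a b) (hf : Continuous f)
    (hent : Dynamics.coverEntropy f Set.univ = 0)
    (K : Set (Set.Icc a b)) (hK : IsMinimalSubset f K)
    (μ : Measure K) [IsProbabilityMeasure μ]
    (hμ : Ergodic (hK.mapsTo.restrict f K K) μ) :
    HasDiscreteSpectrum (hK.mapsTo.restrict f K K) μ := by
  -- Extend `f` to the line by first retracting onto `[a, b]`.
  let F : ℝ → ℝ := fun x ↦ f (Set.projIcc a b hab x)
  have hF : Continuous F := continuous_subtype_val.comp (hf.comp continuous_projIcc)
  have he : Topology.IsClosedEmbedding ((↑) : Set.Icc a b → ℝ) :=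
    isClosed_Icc.isClosedEmbedding_subtypeVal
  have hsc : Function.Semiconj ((↑) : Set.Icc a b → ℝ) f F := fun x ↦ by
    simp only [F, Set.projIcc_val]
  have hFh : ¬ HasHorseshoe F := fun h ↦ by
    have := (h.of_semiconj he hsc (by rintro _ ⟨x, rfl⟩; exact ⟨_, rfl⟩)).coverEntropy_pos
    exact this.ne' hent
  have hrange : Set.range (fun x : K ↦ ((x : Set.Icc a b) : ℝ)) = (↑) '' K := by
    ext y
    simp
  refine hasDiscreteSpectrum_of_not_hasHorseshoe (F := F)
    (π := fun x : K ↦ ((x : Set.Icc a b) : ℝ)) hμ.toMeasurePreserving hF hFh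
    (he.comp hK.isClosed.isClosedEmbedding_subtypeVal).measurableEmbedding
    (fun x ↦ hsc (x : Set.Icc a b)) ?_ ?_
  · rw [hrange]
    exact hK.isClosed.isCompact.image continuous_subtype_val
  · rw [hrange]
    exact hK.image he hsc
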